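/- All graphs are finite and simple. The \emph{chromatic edge-stability number} ${\rm es}_\chi(G)$ of a graph $G$ is the minimum number of edges of $G$ whose removal results in a spanning subgraph $G'$ with $\chi(G')=\chi(G)-1$. A graph $G$ is \emph{$(3,2)$-critical} if $\chi(G)=3$, ${\rm es}_\chi(G)=2$, and ${\rm es}_\chi(G-e)<{\rm es}_\chi(G)$ for every edge $e\in E(G)$. Let $K_2^{(4)}$ be the multigraph on two vertices joined by four parallel edges; let $K_3^{(2,2,1)}$ be the multigraph on three vertices in which two pairs of vertices are joined by two parallel edges each and the third pair by a single edge; and let $C_4^{(2,1,2,1)}$ be the multigraph on four vertices obtained from the $4$-cycle $C_4$ by duplicating two of its non-consecutive edges. A \emph{subdivision} of a multigraph $M$ is a graph obtained from $M$ by replacing its edges with internally disjoint paths of length at least one between the ends of the edges. \textbf{Proposition.} If $G$ is a $(3,2)$-critical graph that contains at least three odd cycles (counted as subgraphs), then $G$ contains a subgraph $H$ such that $H$ is a subdivision of one of the multigraphs $K_2^{(4)}$, $K_4$, $K_3^{(2,2,1)}$, or $C_4^{(2,1,2,1)}$, and $H$ contains at least two odd cycles. -/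

import Mathlib

/-- The chromatic edge-stability number `es_χ(G)`: the minimum number of edges of `G` whose removal
leaves a spanning subgraph `G'` with `χ(G') = χ(G) - 1`.  It is `⊤` when no set of edges
has this property (for instance if `G` has no edges). -/
noncomputable def SimpleGraph.chromaticEdgeStability {V : Type*} (G : SimpleGraph V) : ℕ∞ :=
  sInf {n : ℕ∞ | ∃ S : Set (Sym2 V), S ⊆ G.edgeSet ∧
    (G.deleteEdges S).chromaticNumber + 1 = G.chromaticNumber ∧ S.encard = n}

/-- `G` is edge-stability critical: deleting any edge decreases the chromatic edge-stability
number. -/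
def SimpleGraph.IsEdgeStabilityCritical {V : Type*} (G : SimpleGraph V) : Prop :=
  ∀ e ∈ G.edgeSet, (G.deleteEdges {e}).chromaticEdgeStability < G.chromaticEdgeStability

/-- `G` is `(k, l)`-critical (used for `k, l ≥ 2`): it is edge-stability critical, has chromatic
number `k` and chromatic edge-stability number `l`. -/
def SimpleGraph.IsStabilityCritical {V : Type*} (G : SimpleGraph V) (k l : ℕ) : Prop :=
  G.IsEdgeStabilityCritical ∧ G.chromaticNumber = k ∧ G.chromaticEdgeStability = l

/-- The odd cycles of `G`, as subgraphs of `G`. -/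
def SimpleGraph.oddCycles {V : Type*} (G : SimpleGraph V) : Set G.Subgraph :=
  {C | ∃ (v : V) (p : G.Walk v v), p.IsCycle ∧ Odd p.length ∧ p.toSubgraph = C}

/-- The subgraph `H` of the simple graph `G` is a subdivision of the multigraph `M`: the vertices
of `M` are represented by distinct (branch) vertices of `H`, the edges of `M` by pairwise
edge-disjoint paths `P e` (cycles, for loops) joining the branch vertices that represent
the ends of the edge, no such path meets a branch vertex other than its two ends, two of these
paths meet only in branch vertices representing common ends of their two edges, and `H` consists
exactly of the branch vertices and the paths.
A path of length one (an edge that is not subdivided) is allowed. -/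
def SimpleGraph.Subgraph.IsSubdivisionOf {V α β : Type*} {G : SimpleGraph V} (H : G.Subgraph)
    (M : Graph α β) : Prop :=
  ∃ (b : α → V) (P : β → G.Subgraph),
    Set.InjOn b M.vertexSet ∧
    (∀ e x y, M.IsLink e x y → x ≠ y →
      ∃ p : G.Walk (b x) (b y), p.IsPath ∧ p.toSubgraph = P e) ∧
    (∀ e x, M.IsLoopAt e x → ∃ p : G.Walk (b x) (b x), p.IsCycle ∧ p.toSubgraph = P e) ∧
    (∀ e ∈ M.edgeSet, ∀ x ∈ M.vertexSet, b x ∈ (P e).verts → M.Inc e x) ∧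
    (∀ e ∈ M.edgeSet, ∀ f ∈ M.edgeSet, e ≠ f →
      Disjoint (P e).edgeSet (P f).edgeSet ∧
      ∀ v ∈ (P e).verts, v ∈ (P f).verts → ∃ x, M.Inc e x ∧ M.Inc f x ∧ b x = v) ∧
    H.verts = b '' M.vertexSet ∪ ⋃ e ∈ M.edgeSet, (P e).verts ∧
    H.edgeSet = ⋃ e ∈ M.edgeSet, (P e).edgeSet

/-- The multigraph with vertex set `α` and edge set `β`, where `ends e` is the unordered pair of
ends of the edge `e`. -/
def multigraphOfEnds {α β : Type*} (ends : β → Sym2 α) : Graph α β where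
  vertexSet := Set.univ
  edgeSet := Set.univ
  IsLink e x y := ends e = s(x, y)
  isLink_symm _ _ := ⟨fun _ _ h => h.trans Sym2.eq_swap⟩
  eq_or_eq_of_isLink_of_isLink e x y v w h₁ h₂ := by
    have h := h₁.symm.trans h₂
    rw [Sym2.eq_iff] at h
    tauto
  edge_mem_iff_exists_isLink e := by
    simp only [Set.mem_univ, true_iff]
    induction h : ends e with
    | _ x y => exact ⟨x, y, rfl⟩
  left_mem_of_isLink _ _ _ _ := Set.mem_univ _

/-- `K_2^{(4)}`: two vertices joined by four parallel edges. -/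
def multigraphK2 : Graph (Fin 2) (Fin 4) :=
  multigraphOfEnds ![s(0, 1), s(0, 1), s(0, 1), s(0, 1)]

/-- `K_4`: the complete graph on four vertices. -/
def multigraphK4 : Graph (Fin 4) (Fin 6) :=
  multigraphOfEnds ![s(0, 1), s(0, 2), s(0, 3), s(1, 2), s(1, 3), s(2, 3)]

/-- `K_3^{(2,2,1)}`: three vertices, two pairs of which are joined by two parallel edges and the
third pair by a single edge. -/
def multigraphK3 : Graph (Fin 3) (Fin 5) :=
  multigraphOfEnds ![s(0, 1), s(0, 1), s(1, 2), s(1, 2), s(2, 0)]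

/-- `C_4^{(2,1,2,1)}`: the 4-cycle with two non-consecutive edges duplicated. -/
def multigraphC4 : Graph (Fin 4) (Fin 6) :=
  multigraphOfEnds ![s(0, 1), s(0, 1), s(1, 2), s(2, 3), s(2, 3), s(3, 0)]

/-! Criticality enters only through `IsStabilityCritical.exists_mem_edges`: for an edge `e`, one
further edge meets all odd cycles of `G - e`, so any two odd cycles that avoid `e` share an edge.
Hence three odd cycles cannot be pairwise edge-disjoint (take `e` on the third), and some odd cycle
`C` shares an edge with another cycle. The latter contains an ear of `C`, and `C` with this ear is a
theta `T`. A theta with an odd cycle has exactly two odd cycles (`IsTheta.exists_oddCycles_eq`), so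
a third odd cycle `D` leaves `T`. For an edge `e` of the ear, either `D` uses `e`, or `C` and `D`
both avoid `e` and share an edge. Either way `D` meets `T` in two vertices and so contains an ear of
`T`. A theta plus an ear is a subdivision of one of the four multigraphs, according to the position
of the ends of the ear (`isTripleSubdivision_add`), and it keeps the two odd cycles of `T`. This
case analysis uses `IsPathSystem`, a list of paths labelled by their ends, where adding an ear or
splitting a path only changes the front of the list. -/

namespace SimpleGraph

variable {V : Type*} {G : SimpleGraph V}

/-! ### Cycles, internally disjoint paths and ears -/

namespace Walk

/-- Two walks with the same ends are internally disjoint if they share no edge and no vertex other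
than the ends. -/
structure InternallyDisjoint {u v : V} (p q : G.Walk u v) : Prop where
  edges : p.edges.Disjoint q.edges
  support : ∀ z ∈ p.support, z ∈ q.support → z = u ∨ z = v

theorem InternallyDisjoint.symm {u v : V} {p q : G.Walk u v} (h : p.InternallyDisjoint q) :
    q.InternallyDisjoint p :=
  ⟨h.edges.symm, fun z hz hz' => h.support z hz' hz⟩

theorem InternallyDisjoint.isCycle {u v : V} {p q : G.Walk u v} (h : p.InternallyDisjoint q)
    (hp : p.IsPath) (hq : q.IsPath) (huv : u ≠ v) : (p.append q.reverse).IsCycle := by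
  apply hp.isCycle_append hq.reverse
  · intro z hz hz'
    have h1 := h.support z (List.mem_of_mem_tail hz) (by simpa using List.mem_of_mem_tail hz')
    have h2 : z ≠ u := by
      rintro rfl
      have := hp.support_nodup
      rw [← cons_tail_support, List.nodup_cons] at this
      exact this.1 hz
    have h3 : z ≠ v := by
      rintro rfl
      have := hq.reverse.support_nodup
      rw [← cons_tail_support, List.nodup_cons] at this
      exact this.1 hz'
    tauto
  -- Two paths of length one would both consist of the edge `s(u, v)`, against edge-disjointness.
  · by_contra! hlen
    have hp1 : p.length = 1 := by
      have : p.length ≠ 0 := fun h0 => huv (eq_of_length_eq_zero h0)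
      omega
    have hq1 : q.length = 1 := by
      have : q.length ≠ 0 := fun h0 => huv (eq_of_length_eq_zero h0)
      have := hlen.2
      rw [length_reverse] at this
      omega
    have key : ∀ r : G.Walk u v, r.length = 1 → s(u, v) ∈ r.edges := by
      intro r hr
      cases r with
      | nil => simp at hr
      | cons h r => cases r with
        | nil => simp
        | cons => simp at hr
    exact h.edges (key p hp1) (key q hq1)

theorem toSubgraph_append_reverse {u v : V} (p q : G.Walk u v) :
    (p.append q.reverse).toSubgraph = p.toSubgraph ⊔ q.toSubgraph := by
  rw [toSubgraph_append, toSubgraph_reverse]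

theorem IsTrail.length_eq_of_toSubgraph_eq {u v x y : V} {p : G.Walk u v} {q : G.Walk x y}
    (hp : p.IsTrail) (hq : q.IsTrail) (h : p.toSubgraph = q.toSubgraph) :
    p.length = q.length := by
  rw [← length_edges, ← length_edges]
  apply List.Perm.length_eq
  rw [List.perm_ext_iff_of_nodup hp.edges_nodup hq.edges_nodup]
  intro e
  rw [← mem_edges_toSubgraph, ← mem_edges_toSubgraph, h]

/-- Both cycles have degree two at `x`, so where `H` looks like `c`, the cycle `d` has no choice. -/
theorem IsCycle.neighborSet_eq_of_le {u v x : V} {c : G.Walk u u} {d : G.Walk v v}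
    (hc : c.IsCycle) (hd : d.IsCycle) (hx : x ∈ d.support) {H : G.Subgraph}
    (hH : H.neighborSet x = c.toSubgraph.neighborSet x) (hxc : x ∈ c.support)
    (h : d.toSubgraph ≤ H) :
    d.toSubgraph.neighborSet x = H.neighborSet x := by
  have h1 : d.toSubgraph.neighborSet x ⊆ H.neighborSet x := fun y hy => h.2 hy
  rw [hH] at h1 ⊢
  apply Set.eq_of_subset_of_ncard_le h1 _ c.finite_neighborSet_toSubgraph
  rw [hc.ncard_neighborSet_toSubgraph_eq_two hxc, hd.ncard_neighborSet_toSubgraph_eq_two hx]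

/-- A cycle contained in a cycle is equal to it. -/
theorem IsCycle.toSubgraph_eq_of_le {u v : V} {c : G.Walk u u} {d : G.Walk v v}
    (hc : c.IsCycle) (hd : d.IsCycle) (h : d.toSubgraph ≤ c.toSubgraph) :
    d.toSubgraph = c.toSubgraph := by
  classical
  have hdc : ∀ x ∈ d.support, x ∈ c.support := fun x hx => by
    simpa using h.1 (d.mem_verts_toSubgraph.2 hx)
  have hn : ∀ x ∈ d.support, d.toSubgraph.neighborSet x = c.toSubgraph.neighborSet x :=
    fun x hx => hc.neighborSet_eq_of_le hd hx rfl (hdc x hx) h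
  -- As `c` and `d` have the same neighbours along `d`, a walk inside `c` that starts on `d` never
  -- leaves `d`. It is applied to `c` rotated to start at `v`.
  have hw : ∀ {a b : V} (w : G.Walk a b), (∀ e ∈ w.edges, e ∈ c.edges) → a ∈ d.support →
      ∀ y ∈ w.support, y ∈ d.support := by
    intro a b w
    induction w with
    | nil => intro _ ha y hy; simp at hy; exact hy ▸ ha
    | @cons a b _ hab w ih =>
      intro he ha y hy
      have hb : b ∈ d.support := by
        have : b ∈ c.toSubgraph.neighborSet a := by
          change s(a, b) ∈ c.toSubgraph.edgeSet
          rw [mem_edges_toSubgraph]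
          exact he _ (by simp)
        rw [← hn a ha] at this
        exact d.mem_verts_toSubgraph.1 this.snd_mem
      rw [support_cons, List.mem_cons] at hy
      rcases hy with rfl | hy
      · exact ha
      · exact ih (fun e h => he e (by simp [h])) hb y hy
  have hcd : ∀ x ∈ c.support, x ∈ d.support := by
    intro x hx
    have hv := hdc v d.start_mem_support
    apply hw (c.rotate v hv) _ d.start_mem_support x
    · rw [← mem_verts_toSubgraph, toSubgraph_rotate]
      exact c.mem_verts_toSubgraph.2 hx
    · intro e he
      rw [← mem_edges_toSubgraph, toSubgraph_rotate] at he
      exact c.mem_edges_toSubgraph.1 he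
  refine le_antisymm h ⟨fun x hx => ?_, fun a b hab => ?_⟩
  · exact d.mem_verts_toSubgraph.2 (hcd x (c.mem_verts_toSubgraph.1 hx))
  · have : b ∈ c.toSubgraph.neighborSet a := hab
    rw [← hn a (hcd a (c.mem_verts_toSubgraph.1 hab.fst_mem))] at this
    exact this

/-- Rotate the cycle to start at `x` and cut it at `y`. The lengths are recorded for later parity
arguments. -/
theorem IsCycle.exists_internallyDisjoint {w x y : V} {c : G.Walk w w} (hc : c.IsCycle)
    (hx : x ∈ c.support) (hy : y ∈ c.support) (hxy : x ≠ y) :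
    ∃ p q : G.Walk x y, p.IsPath ∧ q.IsPath ∧ p.InternallyDisjoint q ∧
      p.toSubgraph ⊔ q.toSubgraph = c.toSubgraph ∧ p.length + q.length = c.length := by
  classical
  have hc' : (c.rotate x hx).IsCycle := hc.rotate hx
  have hy' : y ∈ (c.rotate x hx).support := by
    rw [← mem_verts_toSubgraph, toSubgraph_rotate]
    exact c.mem_verts_toSubgraph.2 hy
  have hlen : (c.rotate x hx).length = c.length := by simp
  have hsub : (c.rotate x hx).toSubgraph = c.toSubgraph := toSubgraph_rotate ..
  generalize c.rotate x hx = d at *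
  have hspec := d.take_spec hy'
  set p := d.takeUntil y hy' with hp
  set q := d.dropUntil y hy' with hq
  clear_value p q
  subst hspec
  have hpn : ¬ p.Nil := fun h => hxy h.eq
  have hqn : ¬ q.Nil := fun h => hxy h.eq.symm
  refine ⟨p, q.reverse, hc'.isPath_of_append_left hqn,
    (hc'.isPath_of_append_right hpn).reverse, ⟨?_, ?_⟩, ?_, ?_⟩
  · have := hc'.1.1.edges_nodup
    rw [edges_append, List.nodup_append'] at this
    simpa using this.2.2
  · intro z hz hz'
    have h2 := hc'.2
    rw [tail_support_append, List.nodup_append'] at h2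
    rw [support_reverse, List.mem_reverse, ← cons_tail_support, List.mem_cons] at hz'
    rw [← cons_tail_support, List.mem_cons] at hz
    rcases hz with hz | hz
    · exact Or.inl hz
    · rcases hz' with hz' | hz'
      · exact Or.inr hz'
      · exact (h2.2.2 hz hz').elim
  · rw [toSubgraph_reverse, ← toSubgraph_append, hsub]
  · rw [length_reverse, ← length_append, hlen]

/-- The path `q` meets the subgraph `H` exactly in its two distinct ends. -/
structure IsEar (H : G.Subgraph) {x y : V} (q : G.Walk x y) : Prop where
  isPath : q.IsPath
  ne : x ≠ y
  left_mem : x ∈ H.verts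
  right_mem : y ∈ H.verts
  support : ∀ z ∈ q.support, z ∈ H.verts → z = x ∨ z = y
  edges : ∀ e ∈ q.edges, e ∉ H.edgeSet

/-- Cut `p` at an interior vertex lying in `H` and keep the piece that contains `e`; when no such
vertex is left, the piece is an ear. -/
theorem IsPath.exists_isEar {H : G.Subgraph} {x y : V} {p : G.Walk x y} (hp : p.IsPath)
    (hx : x ∈ H.verts) (hy : y ∈ H.verts) {e : Sym2 V} (he : e ∈ p.edges) (heH : e ∉ H.edgeSet) :
    ∃ (x' y' : V) (q : G.Walk x' y'), q.IsEar H ∧ ∀ e ∈ q.edges, e ∈ p.edges := by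
  classical
  induction hn : p.length using Nat.strongRec generalizing x y with | ind n ih =>
  by_cases! hz : ∃ z ∈ p.support, z ∈ H.verts ∧ z ≠ x ∧ z ≠ y
  · obtain ⟨z, hz, hzH, hzx, hzy⟩ := hz
    have he' := he
    rw [← p.take_spec hz, edges_append, List.mem_append] at he'
    rcases he' with he' | he'
    · obtain ⟨x', y', q, hq, hq'⟩ := ih _ (hn ▸ length_takeUntil_lt_length hz hzy)
        (hp.takeUntil hz) hx hzH he' rfl
      exact ⟨x', y', q, hq, fun e h => p.edges_takeUntil_subset_edges hz (hq' e h)⟩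
    · obtain ⟨x', y', q, hq, hq'⟩ := ih _ (hn ▸ length_dropUntil_lt_length hz hzx)
        (hp.dropUntil hz) hzH hy he' rfl
      exact ⟨x', y', q, hq, fun e h => p.edges_dropUntil_subset_edges hz (hq' e h)⟩
  · have hxy : x ≠ y := by
      rintro rfl
      rw [isPath_iff_nil.1 hp |>.eq_nil] at he
      simp at he
    refine ⟨x, y, p, ⟨hp, hxy, hx, hy, fun z h1 h2 => ?_, fun f hf hfH => heH ?_⟩, fun _ h => h⟩
    -- An edge of `p` in `H` has both ends in `{x, y}`, so it is all of `p` and equals `e`, which is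
    -- not in `H`.
    · by_contra! h
      exact h.2 (hz z h1 h2 h.1)
    · have hends : ∀ z ∈ f, z = x ∨ z = y := by
        intro z hzf
        by_contra! h
        exact h.2 (hz z (p.mem_support_of_mem_edges hf hzf)
          (H.mem_verts_of_mem_edge hfH hzf) h.1)
      have hfxy : f = s(x, y) := by
        have hfG := p.edges_subset_edgeSet hf
        induction f with | _ a b =>
        have hab : a ≠ b := G.ne_of_adj hfG
        have ha := hends a (by simp)
        have hb := hends b (by simp)
        grind
      subst hfxy
      have hlen := hp.length_eq_one_of_mem_edges hf
      have hle : p.edges.length = 1 := by rw [length_edges, hlen]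
      obtain ⟨g, hg⟩ := List.length_eq_one_iff.1 hle
      rw [hg, List.mem_singleton] at he hf
      rw [he, ← hf]
      exact hfH

/-- A cycle that meets a subgraph in two vertices and is not contained in it contains an ear. -/
theorem IsCycle.exists_isEar {H : G.Subgraph} {w x y : V} {c : G.Walk w w} (hc : c.IsCycle)
    (hx : x ∈ c.support) (hy : y ∈ c.support) (hxy : x ≠ y) (hxH : x ∈ H.verts)
    (hyH : y ∈ H.verts) (h : ¬ c.toSubgraph ≤ H) :
    ∃ (x' y' : V) (q : G.Walk x' y'), q.IsEar H ∧ ∀ e ∈ q.edges, e ∈ c.edges := by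
  rw [toSubgraph_le_iff hc.not_nil, Set.not_subset] at h
  obtain ⟨e, he, heH⟩ := h
  obtain ⟨p, q, hp, hq, -, hpq, -⟩ := hc.exists_internallyDisjoint hx hy hxy
  have key : ∀ e, e ∈ c.edges ↔ e ∈ p.edges ∨ e ∈ q.edges := by
    intro e
    rw [← mem_edges_toSubgraph, ← mem_edges_toSubgraph, ← mem_edges_toSubgraph, ← hpq,
      Subgraph.edgeSet_sup, Set.mem_union]
  rcases (key e).1 he with he | he
  · obtain ⟨x', y', r, hr, hr'⟩ := hp.exists_isEar hxH hyH he heH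
    exact ⟨x', y', r, hr, fun e h => (key e).2 (.inl (hr' e h))⟩
  · obtain ⟨x', y', r, hr, hr'⟩ := hq.exists_isEar hxH hyH he heH
    exact ⟨x', y', r, hr, fun e h => (key e).2 (.inr (hr' e h))⟩

/-- A set of edges that at every interior vertex of a path contains all or none of the edges of the
path contains all of its edges as soon as it contains one. -/
theorem IsPath.forall_edges_of_exists {S : Set (Sym2 V)} {x y : V} {p : G.Walk x y}
    (hp : p.IsPath)
    (h : ∀ z ∈ p.support, z ≠ x → z ≠ y → ∀ e ∈ p.edges, z ∈ e → e ∈ S →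
      ∀ f ∈ p.edges, z ∈ f → f ∈ S) {e : Sym2 V} (he : e ∈ p.edges) (heS : e ∈ S) :
    ∀ f ∈ p.edges, f ∈ S := by
  induction p generalizing e with
  | nil => simp at he
  | @cons x w y hxw p ih =>
    have hp' := (cons_isPath_iff _ _).1 hp
    cases p with
    | nil => intro f hf; simp at hf he; rw [hf, ← he]; exact heS
    | @cons _ z _ hwz p =>
      have hwy : w ≠ y := by
        rintro rfl
        have := ((cons_isPath_iff _ _).1 hp'.1).2
        exact this p.end_mem_support
      have hw := h w (by simp) hxw.ne' hwy
      have ih' := @ih hp'.1 (fun z hz hzw hzy e he hze heS f hf hzf =>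
        h z (by rw [support_cons]; exact List.mem_cons_of_mem _ hz)
          (by rintro rfl; exact hp'.2 hz) hzy e (by rw [edges_cons]; exact List.mem_cons_of_mem _ he)
          hze heS f (by rw [edges_cons]; exact List.mem_cons_of_mem _ hf) hzf)
      have hS : s(w, z) ∈ S := by
        rw [edges_cons, List.mem_cons] at he
        rcases he with rfl | he
        · exact hw s(x, w) (by simp) (by simp) heS s(w, z) (by simp) (by simp)
        · exact ih' he heS _ (by simp)
      intro f hf
      rw [edges_cons, List.mem_cons] at hf
      rcases hf with rfl | hf
      · exact hw s(w, z) (by simp) (by simp) hS _ (by simp) (by simp)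
      · exact ih' (e := s(w, z)) (by simp) hS f hf

end Walk

/-! ### Theta graphs and their odd cycles -/

namespace Walk

theorem exists_mem_edges_of_ne {u v : V} (p : G.Walk u v) (h : u ≠ v) : ∃ e, e ∈ p.edges := by
  cases p with
  | nil => exact (h rfl).elim
  | cons => exact ⟨_, by rw [edges_cons]; exact List.mem_cons_self⟩

/-- Three pairwise internally disjoint paths between two distinct vertices. -/
structure IsTheta {u v : V} (p q r : G.Walk u v) : Prop where
  ne : u ≠ v
  isPath₁ : p.IsPath
  isPath₂ : q.IsPath
  isPath₃ : r.IsPath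
  disj₁₂ : p.InternallyDisjoint q
  disj₁₃ : p.InternallyDisjoint r
  disj₂₃ : q.InternallyDisjoint r

namespace IsTheta

variable {u v : V} {p q r : G.Walk u v}

theorem swap (h : IsTheta p q r) : IsTheta q p r :=
  ⟨h.ne, h.isPath₂, h.isPath₁, h.isPath₃, h.disj₁₂.symm, h.disj₂₃, h.disj₁₃⟩

/-- At an interior vertex of `p` the theta looks like the cycle formed by `p` and `q`. A cycle
through this vertex therefore uses both edges of `p` there, and this propagates along `p`. -/
theorem cycle_edges_left (h : IsTheta p q r) {w : V} {d : G.Walk w w} (hd : d.IsCycle)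
    (hle : d.toSubgraph ≤ p.toSubgraph ⊔ q.toSubgraph ⊔ r.toSubgraph) {e : Sym2 V}
    (he : e ∈ p.edges) (hed : e ∈ d.edges) : ∀ f ∈ p.edges, f ∈ d.toSubgraph.edgeSet := by
  refine h.isPath₁.forall_edges_of_exists (S := d.toSubgraph.edgeSet) ?_ he
    (d.mem_edges_toSubgraph.2 hed)
  intro z hz hzu hzv e he hze heS f hf hzf
  have hzd : z ∈ d.support := d.mem_verts_toSubgraph.1 (Subgraph.mem_verts_of_mem_edge heS hze)
  have hzr : z ∉ r.support := fun hr => by have := h.disj₁₃.support z hz hr; tauto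
  have hc := h.disj₁₂.isCycle h.isPath₁ h.isPath₂ h.ne
  have hn := hc.neighborSet_eq_of_le (x := z) hd hzd (H := p.toSubgraph ⊔ q.toSubgraph ⊔ r.toSubgraph)
    (by
      rw [toSubgraph_append_reverse]
      ext y
      simp only [Subgraph.mem_neighborSet, Subgraph.sup_adj]
      refine or_iff_left fun h => hzr ?_
      exact r.mem_verts_toSubgraph.1 h.fst_mem)
    (by simp [mem_support_append_iff, hz]) hle
  obtain ⟨y, rfl⟩ := Sym2.mem_iff_exists.1 hzf
  have : y ∈ (p.toSubgraph ⊔ q.toSubgraph ⊔ r.toSubgraph).neighborSet z :=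
    Or.inl (Or.inl (p.mem_edges_toSubgraph.2 hf))
  rw [← hn] at this
  exact this

/-- Missing one edge of `p`, the cycle misses them all, so it lies in the cycle formed by `q` and
`r`. -/
theorem cycle_eq_of_notMem (h : IsTheta p q r) {w : V} {d : G.Walk w w} (hd : d.IsCycle)
    (hle : d.toSubgraph ≤ p.toSubgraph ⊔ q.toSubgraph ⊔ r.toSubgraph) {e : Sym2 V}
    (he : e ∈ p.edges) (hed : e ∉ d.edges) :
    d.toSubgraph = q.toSubgraph ⊔ r.toSubgraph := by
  rw [← toSubgraph_append_reverse]
  apply (h.disj₂₃.isCycle h.isPath₂ h.isPath₃ h.ne).toSubgraph_eq_of_le hd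
  rw [toSubgraph_append_reverse, toSubgraph_le_iff hd.not_nil]
  intro f hf
  have hf' := Subgraph.edgeSet_mono hle (d.mem_edges_toSubgraph.2 hf)
  simp only [Subgraph.edgeSet_sup, Set.mem_union] at hf' ⊢
  rcases hf' with (hf' | hf') | hf'
  · have := h.cycle_edges_left hd hle (p.mem_edges_toSubgraph.1 hf') hf e he
    exact (hed (d.mem_edges_toSubgraph.1 this)).elim
  · exact .inl hf'
  · exact .inr hf'

theorem cycle_eq (h : IsTheta p q r) {w : V} {d : G.Walk w w} (hd : d.IsCycle)
    (hle : d.toSubgraph ≤ p.toSubgraph ⊔ q.toSubgraph ⊔ r.toSubgraph) :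
    d.toSubgraph = p.toSubgraph ⊔ q.toSubgraph ∨ d.toSubgraph = p.toSubgraph ⊔ r.toSubgraph ∨
      d.toSubgraph = q.toSubgraph ⊔ r.toSubgraph := by
  by_cases! hp : ∃ e ∈ p.edges, e ∉ d.edges
  · obtain ⟨e, he, hed⟩ := hp
    exact .inr (.inr (h.cycle_eq_of_notMem hd hle he hed))
  by_cases! hq : ∃ e ∈ q.edges, e ∉ d.edges
  · obtain ⟨e, he, hed⟩ := hq
    exact .inr (.inl (h.swap.cycle_eq_of_notMem hd (by rwa [sup_comm q.toSubgraph]) he hed))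
  left
  have hc := h.disj₁₂.isCycle h.isPath₁ h.isPath₂ h.ne
  have := hd.toSubgraph_eq_of_le hc (by
    rw [toSubgraph_append_reverse]
    have hpn : ¬ p.Nil := fun hn => h.ne hn.eq
    have hqn : ¬ q.Nil := fun hn => h.ne hn.eq
    refine sup_le ?_ ?_
    · rw [toSubgraph_le_iff hpn]
      exact fun e he => d.mem_edges_toSubgraph.2 (hp e he)
    · rw [toSubgraph_le_iff hqn]
      exact fun e he => d.mem_edges_toSubgraph.2 (hq e he))
  rw [← this, toSubgraph_append_reverse]

/-- A theta with an odd cycle has exactly two odd cycles. -/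
theorem exists_oddCycles_eq (h : IsTheta p q r) (hodd : Odd (p.length + q.length)) :
    ∃ A ∈ G.oddCycles, A ≠ p.toSubgraph ⊔ q.toSubgraph ∧
      A ≤ p.toSubgraph ⊔ q.toSubgraph ⊔ r.toSubgraph ∧
      ∀ D ∈ G.oddCycles, D ≤ p.toSubgraph ⊔ q.toSubgraph ⊔ r.toSubgraph →
        D = p.toSubgraph ⊔ q.toSubgraph ∨ D = A := by
  -- The lengths of `p` and `q` differ in parity, so exactly one of them differs in parity from that
  -- of `r`.
  wlog hpr : Odd (p.length + r.length) generalizing p q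
  · have hqr : Odd (q.length + r.length) := by grind
    have := this h.swap (by rwa [add_comm]) hqr
    rwa [sup_comm q.toSubgraph] at this
  have hc13 := h.disj₁₃.isCycle h.isPath₁ h.isPath₃ h.ne
  have hc23 := h.disj₂₃.isCycle h.isPath₂ h.isPath₃ h.ne
  refine ⟨p.toSubgraph ⊔ r.toSubgraph, ⟨u, _, hc13, ?_, toSubgraph_append_reverse _ _⟩, ?_, ?_, ?_⟩
  · rwa [length_append, length_reverse]
  · intro heq
    obtain ⟨e, he⟩ := exists_mem_edges_of_ne r h.ne
    have : e ∈ (p.toSubgraph ⊔ r.toSubgraph).edgeSet := by simp [he]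
    rw [heq, Subgraph.edgeSet_sup] at this
    rcases this with h' | h'
    · exact h.disj₁₃.edges (p.mem_edges_toSubgraph.1 h') he
    · exact h.disj₂₃.edges (q.mem_edges_toSubgraph.1 h') he
  · exact sup_le (le_sup_left.trans le_sup_left) le_sup_right
  · rintro D ⟨w, d, hd, hdodd, rfl⟩ hle
    rcases h.cycle_eq hd hle with h' | h' | h'
    · exact .inl h'
    · exact .inr h'
    · rw [← toSubgraph_append_reverse] at h'
      have := IsTrail.length_eq_of_toSubgraph_eq hd.1.1 hc23.1.1 h'
      rw [length_append, length_reverse] at this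
      grind

end IsTheta
end Walk

/-! ### The use of criticality -/

/-- In an edge-stability critical graph with chromatic number `3` and stability number `2`, two
odd cycles avoiding a common edge share an edge. -/
theorem IsStabilityCritical.exists_mem_edges {G : SimpleGraph V} (hG : G.IsStabilityCritical 3 2)
    {e : Sym2 V} (he : e ∈ G.edgeSet) {x y : V} {c : G.Walk x x} {d : G.Walk y y}
    (hc : Odd c.length) (hd : Odd d.length) (hec : e ∉ c.edges) (hed : e ∉ d.edges) :
    ∃ f ∈ c.edges, f ∈ d.edges := by
  by_contra! hcd
  have hlt := hG.1 e he
  rw [hG.2.2, chromaticEdgeStability, sInf_lt_iff] at hlt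
  obtain ⟨n, ⟨S, -, hS, rfl⟩, hn⟩ := hlt
  have hS1 : S.encard ≤ 1 := Order.le_of_lt_add_one (by simpa [one_add_one_eq_two] using hn)
  rw [Set.encard_le_one_iff] at hS1
  have h3 : (G.deleteEdges {e}).chromaticNumber ≤ 3 := by
    have := chromaticNumber_mono (G' := G) (G := G.deleteEdges {e}) (G.deleteEdges_le _)
    rw [hG.2.1] at this
    exact this
  -- Deleting `S` from `G - e` lowers a chromatic number that is at most 3, so no odd closed walk
  -- survives. As `S` has at most one edge, the two cycles meet it in the same edge.
  have key : ∀ {z : V} (w : G.Walk z z), Odd w.length → e ∉ w.edges → ∃ f ∈ w.edges, f ∈ S := by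
    intro z w hw hew
    by_contra! hwS
    let w' := (w.toDeleteEdges {e} (fun f hf h => hew (h ▸ hf))).toDeleteEdges S (by simpa using hwS)
    have := w'.three_le_chromaticNumber_of_odd_loop (by simpa [w'] using hw)
    have h4 : (3 : ℕ∞) + 1 ≤ 3 := (add_le_add_left this 1).trans (hS.trans_le h3)
    exact absurd h4 (by decide)
  obtain ⟨f, hf, hfS⟩ := key c hc hec
  obtain ⟨g, hg, hgS⟩ := key d hd hed
  exact hcd f hf (hS1 f g hfS hgS ▸ hg)

/-! ### Path systems and subdivisions -/

namespace Subgraph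

/-- The subgraph `H` is the union of the paths in the list `L`, each recorded together with its
pair of ends; these ends lie in the set `B` of branch vertices, and the paths are edge-disjoint and
meet `B` and each other only in ends. -/
structure IsPathSystem (H : G.Subgraph) (B : Set V) (L : List (G.Subgraph × Sym2 V)) : Prop where
  subset : B ⊆ H.verts
  verts : ∀ z, z ∈ H.verts ↔ ∃ P ∈ L, z ∈ P.1.verts
  edges : ∀ e, e ∈ H.edgeSet ↔ ∃ P ∈ L, e ∈ P.1.edgeSet
  path : ∀ P ∈ L, ∃ (x y : V) (w : G.Walk x y), w.IsPath ∧ x ∈ B ∧ y ∈ B ∧ w.toSubgraph = P.1 ∧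
    P.2 = s(x, y) ∧ ∀ z ∈ w.support, z ∈ B → z = x ∨ z = y
  pairwise : L.Pairwise fun P Q =>
    Disjoint P.1.edgeSet Q.1.edgeSet ∧ ∀ z ∈ P.1.verts, z ∈ Q.1.verts → z ∈ B

namespace IsPathSystem

variable {H : G.Subgraph} {B : Set V} {L L' : List (G.Subgraph × Sym2 V)}

theorem perm (h : H.IsPathSystem B L) (hL : L.Perm L') : H.IsPathSystem B L' where
  subset := h.subset
  verts z := by simp only [h.verts, hL.mem_iff]
  edges e := by simp only [h.edges, hL.mem_iff]
  path P hP := h.path P (hL.mem_iff.2 hP)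
  pairwise := (hL.pairwise_iff fun {_ _} hPQ => ⟨hPQ.1.symm, fun z hz hz' => hPQ.2 z hz' hz⟩).1
    h.pairwise

theorem add (h : H.IsPathSystem B L) {x y : V} {q : G.Walk x y} (hq : q.IsEar H) (hx : x ∈ B)
    (hy : y ∈ B) : (H ⊔ q.toSubgraph).IsPathSystem B ((q.toSubgraph, s(x, y)) :: L) where
  subset := h.subset.trans (fun _ hz => Or.inl hz)
  verts z := by
    simp only [Subgraph.verts_sup, Set.mem_union, h.verts, List.mem_cons, exists_eq_or_imp]
    exact or_comm
  edges e := by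
    simp only [Subgraph.edgeSet_sup, Set.mem_union, h.edges, List.mem_cons, exists_eq_or_imp]
    exact or_comm
  path P hP := by
    rw [List.mem_cons] at hP
    rcases hP with rfl | hP
    · exact ⟨x, y, q, hq.isPath, hx, hy, rfl, rfl, fun z hz hzB => hq.support z hz (h.subset hzB)⟩
    · exact h.path P hP
  pairwise := by
    refine List.pairwise_cons.2 ⟨fun Q hQ => ⟨?_, fun z hz hzQ => ?_⟩, h.pairwise⟩
    · rw [Set.disjoint_left]
      intro e he heQ
      exact hq.edges e (q.mem_edges_toSubgraph.1 he) ((h.edges e).2 ⟨Q, hQ, heQ⟩)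
    · rcases hq.support z (q.mem_verts_toSubgraph.1 hz) ((h.verts z).2 ⟨Q, hQ, hzQ⟩) with rfl | rfl
      · exact hx
      · exact hy

/-- Paths of the system meet only in `B`, so `z` lies on `P` alone and the other paths gain no
interior branch vertex. -/
theorem split_aux {P : G.Subgraph × Sym2 V} (h : H.IsPathSystem B (P :: L)) {x y z : V}
    (hz : z ∈ P.1.verts) (hzB : z ∉ B) {w : G.Walk x y} (hw : w.IsPath) (hx : x ∈ B) (hy : y ∈ B)
    (hwP : w.toSubgraph = P.1) (hwB : ∀ z ∈ w.support, z ∈ B → z = x ∨ z = y) :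
    ∃ A A' : G.Subgraph,
      H.IsPathSystem (insert z B) ((A, s(x, z)) :: (A', s(z, y)) :: L) := by
  classical
  have hzw : z ∈ w.support := by rwa [← Walk.mem_verts_toSubgraph, hwP]
  obtain ⟨p, q, rfl⟩ : ∃ (p : G.Walk x z) (q : G.Walk z y), w = p.append q :=
    ⟨_, _, (w.take_spec hzw).symm⟩
  have hp := hw.of_append_left
  have hq := hw.of_append_right
  have hv : ∀ t, t ∈ P.1.verts ↔ t ∈ p.toSubgraph.verts ∨ t ∈ q.toSubgraph.verts := fun t => by
    rw [← hwP, Walk.toSubgraph_append, Subgraph.verts_sup, Set.mem_union]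
  have he : ∀ e, e ∈ P.1.edgeSet ↔ e ∈ p.toSubgraph.edgeSet ∨ e ∈ q.toSubgraph.edgeSet :=
    fun t => by rw [← hwP, Walk.toSubgraph_append, Subgraph.edgeSet_sup, Set.mem_union]
  have hpq : ∀ t ∈ p.support, t ∈ q.support → t = z := by
    intro t htp htq
    have hnd := hw.support_nodup
    rw [Walk.support_append, List.nodup_append'] at hnd
    rw [← q.cons_tail_support, List.mem_cons] at htq
    exact htq.resolve_right fun htq => hnd.2.2 htp htq
  have hend := List.pairwise_cons.1 h.pairwise
  refine ⟨p.toSubgraph, q.toSubgraph, ?_, ?_, ?_, ?_, ?_⟩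
  · rintro t (rfl | ht)
    · exact (h.verts t).2 ⟨P, List.mem_cons_self, hz⟩
    · exact h.subset ht
  · intro t
    simp only [h.verts, List.mem_cons, exists_eq_or_imp, hv, or_assoc]
  · intro t
    simp only [h.edges, List.mem_cons, exists_eq_or_imp, he, or_assoc]
  · intro Q hQ
    rw [List.mem_cons, List.mem_cons] at hQ
    rcases hQ with rfl | rfl | hQ
    · refine ⟨x, z, p, hp, .inr hx, .inl rfl, rfl, rfl, ?_⟩
      rintro t ht (rfl | htB)
      · exact .inr rfl
      · refine (hwB t ((Walk.mem_support_append_iff _ _).2 (.inl ht)) htB).imp_right ?_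
        rintro rfl
        exact hpq t ht q.end_mem_support
    · refine ⟨z, y, q, hq, .inl rfl, .inr hy, rfl, rfl, ?_⟩
      rintro t ht (rfl | htB)
      · exact .inl rfl
      · refine (hwB t ((Walk.mem_support_append_iff _ _).2 (.inr ht)) htB).imp_left ?_
        rintro rfl
        exact hpq t p.start_mem_support ht
    · obtain ⟨a, b, w', hw', ha, hb, hwQ, hQab, hwB'⟩ := h.path Q (List.mem_cons_of_mem _ hQ)
      refine ⟨a, b, w', hw', .inr ha, .inr hb, hwQ, hQab, ?_⟩
      rintro t ht (rfl | htB)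
      · exact (hzB ((hend.1 Q hQ).2 t hz (hwQ ▸ w'.mem_verts_toSubgraph.2 ht))).elim
      · exact hwB' t ht htB
  · refine List.pairwise_cons.2 ⟨fun Q hQ => ?_, List.pairwise_cons.2 ⟨fun Q hQ => ?_, ?_⟩⟩
    · rw [List.mem_cons] at hQ
      rcases hQ with rfl | hQ
      · refine ⟨?_, fun t ht ht' => .inl ?_⟩
        · have := hw.isTrail.edges_nodup
          rw [Walk.edges_append, List.nodup_append'] at this
          rw [Set.disjoint_left]
          exact fun e he he' => this.2.2 (p.mem_edges_toSubgraph.1 he) (q.mem_edges_toSubgraph.1 he')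
        · exact hpq t (p.mem_verts_toSubgraph.1 ht) (q.mem_verts_toSubgraph.1 ht')
      · exact ⟨(hend.1 Q hQ).1.mono_left fun e h => (he e).2 (.inl h),
          fun t ht htQ => .inr ((hend.1 Q hQ).2 t ((hv t).2 (.inl ht)) htQ)⟩
    · exact ⟨(hend.1 Q hQ).1.mono_left fun e h => (he e).2 (.inr h),
          fun t ht htQ => .inr ((hend.1 Q hQ).2 t ((hv t).2 (.inr ht)) htQ)⟩
    · exact hend.2.imp fun hPQ => ⟨hPQ.1, fun t ht ht' => .inr (hPQ.2 t ht ht')⟩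

/-- A path of the system is subdivided by adding an interior vertex to the branch vertices. -/
theorem split {P : G.Subgraph} {x y z : V} (h : H.IsPathSystem B ((P, s(x, y)) :: L))
    (hz : z ∈ P.verts) (hzB : z ∉ B) :
    ∃ A A' : G.Subgraph,
      H.IsPathSystem (insert z B) ((A, s(x, z)) :: (A', s(z, y)) :: L) := by
  obtain ⟨a, b, w, hw, ha, hb, hwP, hab, hwB⟩ := h.path _ List.mem_cons_self
  rcases Sym2.eq_iff.1 hab with ⟨rfl, rfl⟩ | ⟨rfl, rfl⟩
  · exact h.split_aux hz hzB hw ha hb hwP hwB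
  · exact h.split_aux hz hzB hw.reverse hb ha (by rwa [Walk.toSubgraph_reverse])
      (fun z hz hzB => (hwB z (by simpa using hz) hzB).symm)

/-- Reduces the recognition of a subdivision to reordering the list and comparing end pairs; `hdiag`
makes the loop condition vacuous. -/
theorem isSubdivisionOf {α : Type*} {m : ℕ} {ends : Fin m → Sym2 α} (h : H.IsPathSystem B L)
    (b : α → V) (hb : b.Injective) (hB : Set.range b = B) (P : Fin m → G.Subgraph × Sym2 V)
    (hP : L.Perm (List.ofFn P)) (hends : ∀ e, (P e).2 = (ends e).map b)
    (hdiag : ∀ e, ¬ (ends e).IsDiag) : H.IsSubdivisionOf (multigraphOfEnds ends) := by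
  have hS := h.perm hP
  have hpath : ∀ e, ∃ (x y : V) (w : G.Walk x y), w.IsPath ∧ x ∈ B ∧ y ∈ B ∧
      w.toSubgraph = (P e).1 ∧ (P e).2 = s(x, y) ∧ ∀ z ∈ w.support, z ∈ B → z = x ∨ z = y :=
    fun e => hS.path (P e) (List.mem_ofFn.2 ⟨e, rfl⟩)
  have hinc : ∀ e x, (multigraphOfEnds ends).Inc e x ↔ x ∈ ends e := fun e x =>
    Sym2.mem_iff_exists.symm
  have hmem : ∀ e i, b i ∈ (P e).1.verts → i ∈ ends e := by
    intro e i hi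
    obtain ⟨x, y, w, -, -, -, hwP, hxy, hwB⟩ := hpath e
    rw [← hwP, Walk.mem_verts_toSubgraph] at hi
    have : b i ∈ (ends e).map b := by
      rw [← hends, hxy, Sym2.mem_iff]
      exact hwB _ hi (hB ▸ ⟨i, rfl⟩)
    obtain ⟨j, hj, hji⟩ := Sym2.mem_map.1 this
    exact hb hji ▸ hj
  have hlt : ∀ e f, e < f → Disjoint (P e).1.edgeSet (P f).1.edgeSet ∧
      ∀ z ∈ (P e).1.verts, z ∈ (P f).1.verts → z ∈ B :=
    fun e f hef => List.pairwise_ofFn.1 hS.pairwise hef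
  have hne : ∀ e f, e ≠ f → Disjoint (P e).1.edgeSet (P f).1.edgeSet ∧
      ∀ z ∈ (P e).1.verts, z ∈ (P f).1.verts → z ∈ B := by
    intro e f hef
    rcases lt_or_gt_of_ne hef with hef | hef
    · exact hlt e f hef
    · exact ⟨(hlt f e hef).1.symm, fun z hz hz' => (hlt f e hef).2 z hz' hz⟩
  refine ⟨b, fun e => (P e).1, hb.injOn, ?_, ?_, ?_, ?_, ?_, ?_⟩
  · intro e i j hij _
    obtain ⟨x, y, w, hw, -, -, hwP, hxy, -⟩ := hpath e
    have hij' : ends e = s(i, j) := hij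
    rw [hends, hij', Sym2.map_mk, Sym2.eq_iff] at hxy
    rcases hxy with ⟨rfl, rfl⟩ | ⟨rfl, rfl⟩
    · exact ⟨w, hw, hwP⟩
    · exact ⟨w.reverse, hw.reverse, by rw [Walk.toSubgraph_reverse, hwP]⟩
  · intro e i hi
    have hi' : ends e = s(i, i) := hi
    exact (hdiag e (by rw [hi']; exact Sym2.mk_isDiag_iff.2 rfl)).elim
  · intro e _ i _ hi
    exact (hinc e i).2 (hmem e i hi)
  · intro e _ f _ hef
    refine ⟨(hne e f hef).1, fun z hz hz' => ?_⟩
    have := (hne e f hef).2 z hz hz'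
    rw [← hB] at this
    obtain ⟨i, rfl⟩ := this
    exact ⟨i, (hinc e i).2 (hmem e i hz), (hinc f i).2 (hmem f i hz'), rfl⟩
  · ext z
    have : z ∈ H.verts ↔ ∃ e, z ∈ (P e).1.verts := by
      rw [hS.verts]; simp [List.mem_ofFn]
    simp only [multigraphOfEnds, Set.image_univ, Set.mem_univ, Set.iUnion_true, Set.mem_union,
      Set.mem_iUnion, ← this, hB]
    exact ⟨.inr, fun h' => h'.elim (fun hz => h.subset hz) id⟩
  · ext z
    have : z ∈ H.edgeSet ↔ ∃ e, z ∈ (P e).1.edgeSet := by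
      rw [hS.edges]; simp [List.mem_ofFn]
    simp only [multigraphOfEnds, Set.mem_univ, Set.iUnion_true, Set.mem_iUnion, ← this]

end IsPathSystem
end Subgraph

namespace Walk

theorem IsEar.reverse {H : G.Subgraph} {x y : V} {q : G.Walk x y} (hq : q.IsEar H) :
    q.reverse.IsEar H where
  isPath := hq.isPath.reverse
  ne := hq.ne.symm
  left_mem := hq.right_mem
  right_mem := hq.left_mem
  support z hz hzH := (hq.support z (by simpa using hz) hzH).symm
  edges e he := hq.edges e (by simpa using he)

theorem IsTheta.isPathSystem {u v : V} {p q r : G.Walk u v} (h : IsTheta p q r) :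
    (p.toSubgraph ⊔ q.toSubgraph ⊔ r.toSubgraph).IsPathSystem {u, v}
      [(p.toSubgraph, s(u, v)), (q.toSubgraph, s(u, v)), (r.toSubgraph, s(u, v))] where
  subset := by
    rintro z (rfl | rfl) <;> simp
  verts z := by simp [or_assoc]
  edges e := by simp [or_assoc]
  path P hP := by
    simp only [List.mem_cons, List.not_mem_nil, or_false] at hP
    rcases hP with rfl | rfl | rfl
    · exact ⟨u, v, p, h.isPath₁, .inl rfl, .inr rfl, rfl, rfl, fun _ _ hz => hz⟩
    · exact ⟨u, v, q, h.isPath₂, .inl rfl, .inr rfl, rfl, rfl, fun _ _ hz => hz⟩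
    · exact ⟨u, v, r, h.isPath₃, .inl rfl, .inr rfl, rfl, rfl, fun _ _ hz => hz⟩
  pairwise := by
    have key : ∀ {a b : G.Walk u v}, a.InternallyDisjoint b →
        Disjoint a.toSubgraph.edgeSet b.toSubgraph.edgeSet ∧
          ∀ z ∈ a.toSubgraph.verts, z ∈ b.toSubgraph.verts → z ∈ ({u, v} : Set V) := by
      intro a b hab
      refine ⟨Set.disjoint_left.2 fun e he he' => ?_, fun z hz hz' => ?_⟩
      · exact hab.edges (a.mem_edges_toSubgraph.1 he) (b.mem_edges_toSubgraph.1 he')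
      · exact hab.support z (a.mem_verts_toSubgraph.1 hz) (b.mem_verts_toSubgraph.1 hz')
    simp only [List.pairwise_cons, List.mem_cons, List.not_mem_nil, or_false, forall_eq_or_imp,
      forall_eq, false_imp_iff, implies_true, List.Pairwise.nil, and_true]
    exact ⟨⟨key h.disj₁₂, key h.disj₁₃⟩, key h.disj₂₃⟩

end Walk

/-! ### Adding an ear to a theta -/

namespace Subgraph

/-- `H` is a subdivision of a 2-connected multigraph of cyclomatic number three. -/
def IsTripleSubdivision (H : G.Subgraph) : Prop :=
  H.IsSubdivisionOf multigraphK2 ∨ H.IsSubdivisionOf multigraphK4 ∨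
    H.IsSubdivisionOf multigraphK3 ∨ H.IsSubdivisionOf multigraphC4

namespace IsPathSystem

variable {T : G.Subgraph} {u v x y : V} {A₁ A₂ A₃ A₄ A₅ : G.Subgraph}

theorem exists_split_three
    (h : T.IsPathSystem {u, v} [(A₁, s(u, v)), (A₂, s(u, v)), (A₃, s(u, v))]) (hx : x ∈ T.verts)
    (hxB : x ∉ ({u, v} : Set V)) :
    ∃ B₁ B₂ B₃ B₄ : G.Subgraph, T.IsPathSystem {x, u, v}
      [(B₁, s(u, x)), (B₂, s(x, v)), (B₃, s(u, v)), (B₄, s(u, v))] := by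
  have hx' := (h.verts x).1 hx
  simp only [List.mem_cons, List.not_mem_nil, or_false, exists_eq_or_imp, exists_eq_left] at hx'
  rcases hx' with hx' | hx' | hx'
  · obtain ⟨B, B', hB⟩ := h.split hx' hxB
    exact ⟨B, B', _, _, hB⟩
  · obtain ⟨B, B', hB⟩ := (h.perm (List.Perm.swap ..)).split hx' hxB
    exact ⟨B, B', _, _, hB⟩
  · obtain ⟨B, B', hB⟩ := (h.perm (L' := [(A₃, s(u, v)), (A₁, s(u, v)), (A₂, s(u, v))])
      (List.perm_append_comm (l₁ := [_, _]) (l₂ := [_]))).split hx' hxB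
    exact ⟨B, B', _, _, hB⟩

theorem isSubdivisionOf_K2 {A₁ A₂ A₃ A₄ : G.Subgraph} {T : G.Subgraph} {u v : V} (huv : u ≠ v)
    (h : T.IsPathSystem {u, v} [(A₁, s(u, v)), (A₂, s(u, v)), (A₃, s(u, v)), (A₄, s(u, v))]) :
    T.IsSubdivisionOf multigraphK2 := by
  refine h.isSubdivisionOf ![u, v] ?_ (by simp [Set.pair_comm])
    ![(A₁, s(u, v)), (A₂, s(u, v)), (A₃, s(u, v)), (A₄, s(u, v))] (.refl _) ?_ (by decide)
  · simp [Function.Injective, Fin.forall_fin_succ, huv, huv.symm]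
  · simp [Fin.forall_fin_succ]

theorem isSubdivisionOf_K3 (hyu : y ≠ u) (hyv : y ≠ v) (huv : u ≠ v)
    (h : T.IsPathSystem {y, u, v} [(A₅, s(u, y)), (A₁, s(u, y)), (A₂, s(y, v)), (A₃, s(u, v)),
      (A₄, s(u, v))]) :
    T.IsSubdivisionOf multigraphK3 := by
  refine h.isSubdivisionOf ![y, u, v] ?_ (by simp; grind)
    ![(A₅, s(u, y)), (A₁, s(u, y)), (A₃, s(u, v)), (A₄, s(u, v)), (A₂, s(y, v))] ?_ ?_ (by decide)
  · simp [Function.Injective, Fin.forall_fin_succ, huv, huv.symm, hyu, hyu.symm, hyv, hyv.symm]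
  · exact .cons _ (.cons _ (List.perm_append_comm (l₁ := [_]) (l₂ := [_, _])))
  · simp [Fin.forall_fin_succ]

theorem isSubdivisionOf_C4 {A₆ : G.Subgraph} (hxy : x ≠ y) (hxu : x ≠ u) (hxv : x ≠ v)
    (hyu : y ≠ u) (hyv : y ≠ v) (huv : u ≠ v)
    (h : T.IsPathSystem {y, x, u, v} [(A₆, s(x, y)), (A₁, s(u, y)), (A₂, s(y, x)), (A₃, s(x, v)),
      (A₄, s(u, v)), (A₅, s(u, v))]) :
    T.IsSubdivisionOf multigraphC4 := by
  refine h.isSubdivisionOf ![x, y, u, v] ?_ (by simp; grind)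
    ![(A₆, s(x, y)), (A₂, s(y, x)), (A₁, s(u, y)), (A₄, s(u, v)), (A₅, s(u, v)), (A₃, s(x, v))]
    ?_ ?_ (by decide)
  · simp [Function.Injective, Fin.forall_fin_succ, huv, huv.symm, hyu, hyu.symm, hyv, hyv.symm,
      hxy, hxy.symm, hxu, hxu.symm, hxv, hxv.symm]
  · refine .cons _ ((List.Perm.swap ..).trans (.cons _ (.cons _ ?_)))
    exact List.perm_append_comm (l₁ := [_]) (l₂ := [_, _])
  · simp [Fin.forall_fin_succ]

theorem isSubdivisionOf_K4 {A₆ : G.Subgraph} (hxy : x ≠ y) (hxu : x ≠ u) (hxv : x ≠ v)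
    (hyu : y ≠ u) (hyv : y ≠ v) (huv : u ≠ v)
    (h : T.IsPathSystem {y, x, u, v} [(A₆, s(x, y)), (A₁, s(u, y)), (A₂, s(y, v)), (A₃, s(u, x)),
      (A₄, s(x, v)), (A₅, s(u, v))]) :
    T.IsSubdivisionOf multigraphK4 := by
  refine h.isSubdivisionOf ![u, v, x, y] ?_ (by simp; grind)
    ![(A₅, s(u, v)), (A₃, s(u, x)), (A₁, s(u, y)), (A₄, s(x, v)), (A₂, s(y, v)), (A₆, s(x, y))]
    ?_ ?_ (by decide)
  · simp [Function.Injective, Fin.forall_fin_succ, huv, huv.symm, hyu, hyu.symm, hyv, hyv.symm,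
      hxy, hxy.symm, hxu, hxu.symm, hxv, hxv.symm]
  · refine (List.reverse_perm _).symm.trans (.cons _ ((List.Perm.swap ..).trans (.cons _ ?_)))
    exact List.Perm.append_right [_] (List.perm_append_comm (l₁ := [_, _]) (l₂ := [_]))
  · simp [Fin.forall_fin_succ]

/-- Adding an ear to a theta gives a subdivision of a 2-connected multigraph of cyclomatic number
three. -/
theorem isTripleSubdivision_add (huv : u ≠ v)
    (h : T.IsPathSystem {u, v} [(A₁, s(u, v)), (A₂, s(u, v)), (A₃, s(u, v))]) {q : G.Walk x y}
    (hq : q.IsEar T) : (T ⊔ q.toSubgraph).IsTripleSubdivision := by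
  -- Reversing the ear excludes the case where only `y` is a branch vertex.
  wlog hB : x ∈ ({u, v} : Set V) ∨ y ∉ ({u, v} : Set V) generalizing x y
  · have := this hq.reverse (by tauto)
    rwa [Walk.toSubgraph_reverse] at this
  by_cases hx : x ∈ ({u, v} : Set V)
  · wlog hxu : x = u generalizing u v
    · have hxv : x = v := hx.resolve_left hxu
      rw [Set.pair_comm] at h hB hx
      rw [Sym2.eq_swap] at h
      exact this huv.symm h hB hx hxv
    subst hxu
    by_cases hy : y ∈ ({x, v} : Set V)
    -- Two branch ends give `K_2^{(4)}`; one branch end gives `K_3^{(2,2,1)}`.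
    · obtain rfl : y = v := hy.resolve_left hq.ne.symm
      exact .inl (isSubdivisionOf_K2 huv (h.add hq (.inl rfl) (.inr rfl)))
    · obtain ⟨B₁, B₂, B₃, B₄, h'⟩ := h.exists_split_three hq.right_mem hy
      refine .inr (.inr (.inl (isSubdivisionOf_K3 hq.ne.symm (fun h => hy (.inr h)) huv
        (h'.add hq (.inr (.inl rfl)) (.inl rfl)))))
  · have hy := hB.resolve_left hx
    obtain ⟨B₁, B₂, B₃, B₄, h'⟩ := h.exists_split_three hq.left_mem hx
    have hxu : x ≠ u := fun h => hx (.inl h)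
    have hxv : x ≠ v := fun h => hx (.inr h)
    have hyu : y ≠ u := fun h => hy (.inl h)
    have hyv : y ≠ v := fun h => hy (.inr h)
    have hyB : y ∉ ({x, u, v} : Set V) := fun h => h.elim hq.ne.symm hy
    have hy' := (h'.verts y).1 hq.right_mem
    simp only [List.mem_cons, List.not_mem_nil, or_false, exists_eq_or_imp, exists_eq_left] at hy'
    -- If `y` lies on one of the two halves of the path split at `x`, the result is
    -- `C_4^{(2,1,2,1)}`; the second half reduces to the first shape by exchanging `u` and `v`. If
    -- `y` lies on another path, the result is `K_4`.
    rcases hy' with hy' | hy' | hy' | hy'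
    · obtain ⟨C, C', hC⟩ := h'.split hy' hyB
      exact .inr (.inr (.inr (isSubdivisionOf_C4 hq.ne hxu hxv hyu hyv huv
        (hC.add hq (.inr (.inl rfl)) (.inl rfl)))))
    · have h'' : T.IsPathSystem {x, v, u}
          [(B₂, s(v, x)), (B₁, s(x, u)), (B₃, s(v, u)), (B₄, s(v, u))] := by
        rw [Set.pair_comm, Sym2.eq_swap (a := v) (b := x), Sym2.eq_swap (a := x) (b := u),
          Sym2.eq_swap (a := v) (b := u)]
        exact h'.perm (.swap ..)
      obtain ⟨C, C', hC⟩ := h''.split hy' (by rwa [Set.pair_comm])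
      exact .inr (.inr (.inr (isSubdivisionOf_C4 hq.ne hxv hxu hyv hyu huv.symm
        (hC.add hq (.inr (.inl rfl)) (.inl rfl)))))
    · obtain ⟨C, C', hC⟩ := (h'.perm (L' := [(B₃, s(u, v)), (B₁, s(u, x)), (B₂, s(x, v)),
        (B₄, s(u, v))]) (List.Perm.append_right [_]
          (List.perm_append_comm (l₁ := [_, _]) (l₂ := [_])))).split hy' hyB
      exact .inr (.inl (isSubdivisionOf_K4 hq.ne hxu hxv hyu hyv huv
        (hC.add hq (.inr (.inl rfl)) (.inl rfl))))
    · obtain ⟨C, C', hC⟩ := (h'.perm (L' := [(B₄, s(u, v)), (B₁, s(u, x)), (B₂, s(x, v)),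
        (B₃, s(u, v))]) (List.perm_append_comm (l₁ := [_, _, _]) (l₂ := [_]))).split hy' hyB
      exact .inr (.inl (isSubdivisionOf_K4 hq.ne hxu hxv hyu hyv huv
        (hC.add hq (.inr (.inl rfl)) (.inl rfl))))

end IsPathSystem
end Subgraph

/-! ### Assembling the argument -/

namespace Walk

/-- Closed walks that share an edge share two vertices. -/
theorem exists_ne_of_mem_edges {x y : V} {c : G.Walk x x} {d : G.Walk y y} {e : Sym2 V}
    (hc : e ∈ c.edges) (hd : e ∈ d.edges) :
    ∃ a b, a ≠ b ∧ a ∈ c.support ∧ b ∈ c.support ∧ a ∈ d.support ∧ b ∈ d.support := by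
  have he := c.edges_subset_edgeSet hc
  induction e with | _ a b =>
  exact ⟨a, b, G.ne_of_adj he, c.fst_mem_support_of_mem_edges hc, c.snd_mem_support_of_mem_edges hc,
    d.fst_mem_support_of_mem_edges hd, d.snd_mem_support_of_mem_edges hd⟩

end Walk

theorem IsStabilityCritical.exists_isTripleSubdivision {G : SimpleGraph V}
    (hG : G.IsStabilityCritical 3 2) {C C' : G.Subgraph} (hC : C ∈ G.oddCycles)
    (hC' : C' ∈ G.oddCycles) (hCC' : C' ≠ C) {f : Sym2 V} (hf : f ∈ C.edgeSet)
    (hf' : f ∈ C'.edgeSet) (h3 : ∀ A B : G.Subgraph, ∃ D ∈ G.oddCycles, D ≠ A ∧ D ≠ B) :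
    ∃ H : G.Subgraph, H.IsTripleSubdivision ∧ 2 ≤ {C ∈ G.oddCycles | C ≤ H}.encard := by
  obtain ⟨x, c, hc, hcodd, rfl⟩ := hC
  obtain ⟨y, d, hd, -, rfl⟩ := hC'
  rw [Walk.mem_edges_toSubgraph] at hf hf'
  obtain ⟨a, b, hab, hac, hbc, had, hbd⟩ := Walk.exists_ne_of_mem_edges hf hf'
  -- The second cycle is not contained in `c`, since a cycle inside a cycle equals it; so it
  -- supplies an ear `r` of `c`.
  obtain ⟨u, v, r, hr, -⟩ := hd.exists_isEar had hbd hab (c.mem_verts_toSubgraph.2 hac)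
    (c.mem_verts_toSubgraph.2 hbc) (fun h => hCC' (hc.toSubgraph_eq_of_le hd h))
  obtain ⟨p, q, hp, hq, hpq, hpqc, hlen⟩ := hc.exists_internallyDisjoint
    (c.mem_verts_toSubgraph.1 hr.left_mem) (c.mem_verts_toSubgraph.1 hr.right_mem) hr.ne
  have hpr : p.InternallyDisjoint r := by
    refine ⟨fun e he he' => hr.edges e he' ?_, fun z hz hz' => hr.support z hz' ?_⟩
    · rw [← hpqc, Subgraph.edgeSet_sup]
      exact .inl (p.mem_edges_toSubgraph.2 he)
    · rw [← hpqc]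
      exact .inl (p.mem_verts_toSubgraph.2 hz)
  have hqr : q.InternallyDisjoint r := by
    refine ⟨fun e he he' => hr.edges e he' ?_, fun z hz hz' => hr.support z hz' ?_⟩
    · rw [← hpqc, Subgraph.edgeSet_sup]
      exact .inr (q.mem_edges_toSubgraph.2 he)
    · rw [← hpqc]
      exact .inr (q.mem_verts_toSubgraph.2 hz)
  have hθ : Walk.IsTheta p q r := ⟨hr.ne, hp, hq, hr.isPath, hpq, hpr, hqr⟩
  obtain ⟨A, hA, hAne, hAle, hAeq⟩ := hθ.exists_oddCycles_eq (hlen ▸ hcodd)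
  set T := p.toSubgraph ⊔ q.toSubgraph ⊔ r.toSubgraph with hT
  rw [hpqc] at hAne hAeq
  have hcT : c.toSubgraph ≤ T := by rw [hT, hpqc]; exact le_sup_left
  obtain ⟨D, hD, hDc, hDA⟩ := h3 c.toSubgraph A
  have hDT : ¬ D ≤ T := fun h => (hAeq D hD h).elim hDc hDA
  obtain ⟨w, k, hk, hkodd, rfl⟩ := hD
  obtain ⟨s, t, hst, hs, ht, hsT, htT⟩ : ∃ s t, s ≠ t ∧ s ∈ k.support ∧ t ∈ k.support ∧
      s ∈ T.verts ∧ t ∈ T.verts := by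
    have key : ∀ e ∈ k.edges, e ∈ T.edgeSet → ∃ s t, s ≠ t ∧ s ∈ k.support ∧ t ∈ k.support ∧
        s ∈ T.verts ∧ t ∈ T.verts := by
      intro e he heT
      induction e with | _ s t =>
      exact ⟨s, t, G.ne_of_adj (k.edges_subset_edgeSet he), k.fst_mem_support_of_mem_edges he,
        k.snd_mem_support_of_mem_edges he, Subgraph.mem_verts_of_mem_edge heT (by simp),
        Subgraph.mem_verts_of_mem_edge heT (by simp)⟩
    -- An edge of the ear is avoided by `c`: either `k` uses it, or criticality makes `c` and `k`
    -- share an edge. In both cases `k` has an edge in `T`.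
    obtain ⟨e, he⟩ := r.exists_mem_edges_of_ne hr.ne
    by_cases hek : e ∈ k.edges
    · exact key e hek (Subgraph.edgeSet_mono le_sup_right (r.mem_edges_toSubgraph.2 he))
    · obtain ⟨g, hgc, hgk⟩ := hG.exists_mem_edges (r.edges_subset_edgeSet he) hcodd hkodd
        (fun h => hr.edges e he (c.mem_edges_toSubgraph.2 h)) hek
      exact key g hgk (Subgraph.edgeSet_mono hcT (c.mem_edges_toSubgraph.2 hgc))
  obtain ⟨x', y', q', hq', -⟩ := hk.exists_isEar hs ht hst hsT htT hDT
  refine ⟨T ⊔ q'.toSubgraph, hθ.isPathSystem.isTripleSubdivision_add hr.ne hq', ?_⟩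
  rw [← Set.encard_pair hAne]
  apply Set.encard_le_encard
  rintro B (rfl | rfl)
  · exact ⟨hA, hAle.trans le_sup_left⟩
  · exact ⟨⟨x, c, hc, hcodd, rfl⟩, hcT.trans le_sup_left⟩

end SimpleGraph

theorem mainTheorem3 {V : Type*} [Finite V] (G : SimpleGraph V)
    (hG : G.IsStabilityCritical 3 2) (h3 : 3 ≤ G.oddCycles.encard) :
    ∃ H : G.Subgraph,
      (H.IsSubdivisionOf multigraphK2 ∨ H.IsSubdivisionOf multigraphK4 ∨
        H.IsSubdivisionOf multigraphK3 ∨ H.IsSubdivisionOf multigraphC4) ∧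
      2 ≤ {C ∈ G.oddCycles | C ≤ H}.encard := by
  have h3' : ∀ A B : G.Subgraph, ∃ D ∈ G.oddCycles, D ≠ A ∧ D ≠ B := by
    intro A B
    by_contra! h
    have hsub : G.oddCycles ⊆ {A, B} := fun D hD => by
      by_cases hDA : D = A
      · exact .inl hDA
      · exact .inr (h D hD hDA)
    have hcard : ({A, B} : Set G.Subgraph).encard ≤ 1 + 1 :=
      (Set.encard_insert_le _ _).trans (by rw [Set.encard_singleton])
    exact absurd (h3.trans ((Set.encard_le_encard hsub).trans hcard)) (by decide)
  suffices h : ∃ C ∈ G.oddCycles, ∃ C' ∈ G.oddCycles, C' ≠ C ∧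
      ∃ f ∈ C.edgeSet, f ∈ C'.edgeSet by
    obtain ⟨C, hC, C', hC', hne, f, hf, hf'⟩ := h
    exact hG.exists_isTripleSubdivision hC hC' hne hf hf' h3'
  -- The arguments `⊥` are dummies: nothing has to be avoided yet.
  obtain ⟨C, hC, -⟩ := h3' ⊥ ⊥
  obtain ⟨C', hC', hne, -⟩ := h3' C C
  obtain ⟨D, hD, hDC, hDC'⟩ := h3' C C'
  by_contra! hdisj
  have h1 := hdisj C hC D hD hDC
  have h2 := hdisj C' hC' D hD hDC'
  have h4 := hdisj C hC C' hC' hne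
  obtain ⟨x, c, -, hc, rfl⟩ := hC
  obtain ⟨y, d, -, hd, rfl⟩ := hC'
  obtain ⟨z, k, hk, -, rfl⟩ := hD
  simp only [SimpleGraph.Walk.mem_edges_toSubgraph] at h1 h2 h4
  -- If the three cycles are pairwise edge-disjoint, the first two avoid any edge of the third, so
  -- criticality makes them share an edge.
  obtain ⟨e, he⟩ := List.exists_mem_of_ne_nil k.edges (by
    rw [Ne, SimpleGraph.Walk.edges_eq_nil]
    exact hk.not_nil)
  obtain ⟨f, hf, hf'⟩ := hG.exists_mem_edges (k.edges_subset_edgeSet he) hc hd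
    (fun h => h1 e h he) (fun h => h2 e h he)
  exact h4 f hf hf'
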